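/- Let $R$ be an associative ring with unity, $M$ a unitary right $R$-module, and $S=\operatorname{End}_R(M)$, so that $M$ is a left $S$-module by evaluation. Write $M^{(n)}$ for the direct sum of $n$ copies of $M$. A right $R$-module is called *Rickart* if the kernel of each of its endomorphisms is a direct summand. A right $R$-module $N$ is called *finitely $M$-generated* if there is an epimorphism $M^{(n)}\to N$ for some $n>0$. Then the following conditions are equivalent: (a) $M$ is finite $\Sigma$-Rickart, i.e. $M^{(n)}$ is a Rickart module for every $n>0$; (b) $S$ is right semi-hereditary (every finitely generated right ideal of $S$ is projective as a right $S$-module) and ${}_SM$ is flat; (c) $M$ is intrinsically projective (for all $n>0$, all submodules $N\le M$, all epimorphisms $\alpha:M^{(n)}\to N$ and all homomorphisms $\beta:M\to N$ there is a homomorphism $\gamma:M\to M^{(n)}$ with $\alpha\gamma=\beta$), $M$ is $M$-coherent (for every $n>0$ and every homomorphism $\rho:M^{(n)}\to M$, the kernel $\operatorname{Ker}\rho$ is finitely $M$-generated), and all right ideals of $S$ are flat as right $S$-modules. -/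

import Mathlib

open scoped TensorProduct

namespace RickartMod

section Modules

/-!
A right `R`-module is an additive group with a `Module Rᵐᵒᵖ` structure, as usual in Mathlib.  Its
endomorphism ring `Module.End Rᵐᵒᵖ M` (multiplication is composition) acts on it from the left, by
evaluation.  The direct sum `M^(n)` is `Fin n → M`.
-/

/-- A right `R`-module `M` is *Rickart* if the kernel of every endomorphism of `M` is a direct
summand of `M`. -/
def IsRickart (R M : Type*) [Ring R] [AddCommGroup M] [Module Rᵐᵒᵖ M] : Prop :=
  ∀ φ : Module.End Rᵐᵒᵖ M, ∃ K : Submodule Rᵐᵒᵖ M, IsCompl (LinearMap.ker φ) K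

/-- `M` is *finite Σ-Rickart* if `M^(n)` is a Rickart module for every `n > 0`. -/
def IsFiniteSigmaRickart (R M : Type*) [Ring R] [AddCommGroup M] [Module Rᵐᵒᵖ M] : Prop :=
  ∀ n : ℕ, 0 < n → IsRickart R (Fin n → M)

/-- `N` is *finitely `M`-generated* if there is an epimorphism `M^(n) → N` for some `n > 0`. -/
def IsFinitelyGeneratedBy (R M N : Type*) [Ring R] [AddCommGroup M] [Module Rᵐᵒᵖ M]
    [AddCommGroup N] [Module Rᵐᵒᵖ N] : Prop :=
  ∃ n : ℕ, 0 < n ∧ ∃ π : (Fin n → M) →ₗ[Rᵐᵒᵖ] N, Function.Surjective π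

/-- `N` is *`M`-coherent* if it is finitely `M`-generated and the kernel of every homomorphism
`M^(n) → N`, `n > 0`, is finitely `M`-generated. -/
def IsCoherentOver (R M N : Type*) [Ring R] [AddCommGroup M] [Module Rᵐᵒᵖ M]
    [AddCommGroup N] [Module Rᵐᵒᵖ N] : Prop :=
  IsFinitelyGeneratedBy R M N ∧
    ∀ n : ℕ, 0 < n → ∀ ρ : (Fin n → M) →ₗ[Rᵐᵒᵖ] N,
      IsFinitelyGeneratedBy R M (LinearMap.ker ρ)

/-- `M` is *intrinsically projective* if for every submodule `N ≤ M`, every epimorphism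
`α : M^(n) → N` with `n > 0` and every homomorphism `β : M → N`, there is `γ : M → M^(n)`
with `αγ = β`. -/
def IsIntrinsicallyProjective (R M : Type*) [Ring R] [AddCommGroup M] [Module Rᵐᵒᵖ M] : Prop :=
  ∀ n : ℕ, 0 < n → ∀ (N : Submodule Rᵐᵒᵖ M) (α : (Fin n → M) →ₗ[Rᵐᵒᵖ] N),
    Function.Surjective α → ∀ β : M →ₗ[Rᵐᵒᵖ] N, ∃ γ : M →ₗ[Rᵐᵒᵖ] (Fin n → M), α ∘ₗ γ = β

end Modules

section Tensor

/-!
The tensor product `A ⊗_S B` of a right `S`-module `A` and a left `S`-module `B` over a ring that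
need not be commutative, an additive group.  (Mathlib's `TensorProduct` is used over `ℤ` only.)
-/

/-- The subgroup of `A ⊗_ℤ B` generated by all `(a s) ⊗ b - a ⊗ (s b)`. -/
def balancingRel (S A B : Type*) [Ring S] [AddCommGroup A] [Module Sᵐᵒᵖ A]
    [AddCommGroup B] [Module S B] : AddSubgroup (A ⊗[ℤ] B) :=
  AddSubgroup.closure
    {x | ∃ (a : A) (s : S) (b : B), x = (MulOpposite.op s • a) ⊗ₜ[ℤ] b - a ⊗ₜ[ℤ] (s • b)}

/-- The tensor product `A ⊗_S B` of a right `S`-module `A` and a left `S`-module `B`. -/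
abbrev RingTensor (S A B : Type*) [Ring S] [AddCommGroup A] [Module Sᵐᵒᵖ A]
    [AddCommGroup B] [Module S B] : Type _ :=
  (A ⊗[ℤ] B) ⧸ balancingRel S A B

/-- The map `f ⊗ g : A ⊗_S B → A' ⊗_S B'`, `a ⊗ b ↦ f a ⊗ g b`. -/
def RingTensor.map {S A A' B B' : Type*} [Ring S]
    [AddCommGroup A] [Module Sᵐᵒᵖ A] [AddCommGroup A'] [Module Sᵐᵒᵖ A']
    [AddCommGroup B] [Module S B] [AddCommGroup B'] [Module S B']
    (f : A →ₗ[Sᵐᵒᵖ] A') (g : B →ₗ[S] B') : RingTensor S A B →+ RingTensor S A' B' :=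
  QuotientAddGroup.map (balancingRel S A B) (balancingRel S A' B')
    (TensorProduct.map f.toAddMonoidHom.toIntLinearMap
      g.toAddMonoidHom.toIntLinearMap).toAddMonoidHom <| by
    refine (AddSubgroup.closure_le _).2 ?_
    rintro _ ⟨a, s, b, rfl⟩
    refine AddSubgroup.subset_closure ⟨f a, s, g b, ?_⟩
    rw [map_sub]
    exact congrArg₂ (fun x y => x ⊗ₜ[ℤ] g b - f a ⊗ₜ[ℤ] y) (f.map_smul _ a) (g.map_smul s b)

/-- A left `S`-module `B` is *flat* if `- ⊗_S B` preserves injectivity of homomorphisms of right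
`S`-modules.  (As for Mathlib's `Module.Flat`, modules in the universe of `S` are enough.) -/
def IsFlatLeft.{u, v} (S : Type u) (B : Type v) [Ring S] [AddCommGroup B] [Module S B] : Prop :=
  ∀ (A A' : Type u) [AddCommGroup A] [AddCommGroup A'] [Module Sᵐᵒᵖ A] [Module Sᵐᵒᵖ A']
    (f : A →ₗ[Sᵐᵒᵖ] A'), Function.Injective f →
      Function.Injective (RingTensor.map f (LinearMap.id : B →ₗ[S] B))

/-- A right `S`-module `A` is *flat* if `A ⊗_S -` preserves injectivity of homomorphisms of left
`S`-modules. -/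
def IsFlatRight.{u, v} (S : Type u) (A : Type v) [Ring S] [AddCommGroup A] [Module Sᵐᵒᵖ A] :
    Prop :=
  ∀ (B B' : Type u) [AddCommGroup B] [AddCommGroup B'] [Module S B] [Module S B']
    (g : B →ₗ[S] B'), Function.Injective g →
      Function.Injective (RingTensor.map (LinearMap.id : A →ₗ[Sᵐᵒᵖ] A) g)

end Tensor

section Rings

/-- A right ideal of `S` is a submodule of the right module `S_S`. -/
abbrev RightIdeal (S : Type*) [Ring S] := Submodule Sᵐᵒᵖ S

/-- `S` is *right semi-hereditary* if every finitely generated right ideal is projective as a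
right `S`-module. -/
def IsRightSemihereditary (S : Type*) [Ring S] : Prop :=
  ∀ I : RightIdeal S, I.FG → Module.Projective Sᵐᵒᵖ I

end Rings

end RickartMod

/-! All three conditions are compared with `SplitsRelations`: the kernel of every row `u` over `S`
is the fixed image of a square matrix `E`. Over `M` this says that kernels of maps `M^(n) → M`,
hence of maps `M^(n) → M^(m)`, are summands, which is (a). Over `S` it says that `S^n` splits over
each finitely generated right ideal, i.e. semi-heredity.

Since `S` acts faithfully, `E` also works over `S`, and it yields flatness of `M` by the equational
criterion. Conversely, flatness writes a relation on `M` through columns over `S` killed by `u`, and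
`E` fixes those columns.

For (c), the retraction `E` splits epimorphisms onto submodules of `M` and generates the kernel,
while `1 - E` witnesses flatness of right ideals. Conversely, coherence gives `K` whose image is the
kernel of `u`; flatness of the right ideal generated by `u` gives `u = uWV` with `VK = 0`, and `E =
1 - WV`. -/

namespace RickartMod

open MulOpposite

/-! ### Tensor products and vanishing of tensors -/

section Tensor

variable {S A B G : Type*} [Ring S] [AddCommGroup A] [Module Sᵐᵒᵖ A] [AddCommGroup B] [Module S B]
  [AddCommGroup G]

/-- The biadditive map `(a, b) ↦ a ⊗ b`. -/
def RingTensor.tmul (S A B : Type*) [Ring S] [AddCommGroup A] [Module Sᵐᵒᵖ A]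
    [AddCommGroup B] [Module S B] : A →+ B →+ RingTensor S A B :=
  AddMonoidHom.mk' (fun a => AddMonoidHom.mk'
    (fun b => (QuotientAddGroup.mk (a ⊗ₜ[ℤ] b) : RingTensor S A B))
      fun b b' => by rw [TensorProduct.tmul_add]; rfl)
    fun a a' => by ext b; simp [TensorProduct.add_tmul]

theorem RingTensor.smul_tmul (a : A) (s : S) (b : B) :
    tmul S A B (op s • a) b = tmul S A B a (s • b) :=
  (QuotientAddGroup.eq_iff_sub_mem).2 (AddSubgroup.subset_closure ⟨a, s, b, rfl⟩)

/-- The homomorphism on `A ⊗_S B` given by a balanced biadditive map. -/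
def RingTensor.lift (φ : A →+ B →+ G) (h : ∀ a (s : S) b, φ (op s • a) b = φ a (s • b)) :
    RingTensor S A B →+ G :=
  QuotientAddGroup.lift (balancingRel S A B)
    (TensorProduct.liftAddHom φ fun r a b => by simp) <| by
      refine (AddSubgroup.closure_le _).2 ?_
      rintro _ ⟨a, s, b, rfl⟩
      simp [h]

@[simp]
theorem RingTensor.lift_tmul (φ : A →+ B →+ G) (h : ∀ a (s : S) b, φ (op s • a) b = φ a (s • b))
    (a : A) (b : B) : lift φ h (tmul S A B a b) = φ a b := rfl

@[simp]
theorem RingTensor.map_tmul {A' B' : Type*} [AddCommGroup A'] [Module Sᵐᵒᵖ A'] [AddCommGroup B']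
    [Module S B'] (f : A →ₗ[Sᵐᵒᵖ] A') (g : B →ₗ[S] B') (a : A) (b : B) :
    map f g (tmul S A B a b) = tmul S A' B' (f a) (g b) := rfl

theorem RingTensor.hom_ext {f g : RingTensor S A B →+ G}
    (h : ∀ a b, f (tmul S A B a b) = g (tmul S A B a b)) : f = g := by
  ext x
  change f (QuotientAddGroup.mk x) = g (QuotientAddGroup.mk x)
  induction x using TensorProduct.induction_on with
  | zero => exact (map_zero f).trans (map_zero g).symm
  | tmul a b => exact h a b
  | add x y hx hy => rw [QuotientAddGroup.mk_add, map_add, map_add, hx, hy]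

theorem RingTensor.exists_finsupp (x : RingTensor S A B) :
    ∃ p : A →₀ B, x = p.sum fun a b => tmul S A B a b := by
  obtain ⟨x, rfl⟩ := QuotientAddGroup.mk_surjective x
  induction x using TensorProduct.induction_on with
  | zero => exact ⟨0, by simp⟩
  | tmul a b => exact ⟨Finsupp.single a b, by simp; rfl⟩
  | add x y hx hy =>
    obtain ⟨p, hp⟩ := hx
    obtain ⟨q, hq⟩ := hy
    refine ⟨p + q, ?_⟩
    rw [QuotientAddGroup.mk_add, hp, hq, Finsupp.sum_add_index' (by simp) (by simp)]

/-- `(k, y) ↦ (kᵢ y)ᵢ`, for a finitely supported family `k` of scalars. -/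
noncomputable def scale (S ι B : Type*) [Ring S] [AddCommGroup B] [Module S B] :
    (ι →₀ Sᵐᵒᵖ) →+ B →+ (ι →₀ B) :=
  AddMonoidHom.mk' (fun k => AddMonoidHom.mk'
    (fun y => k.mapRange (fun s => s.unop • y) (by simp)) fun y y' => by ext; simp)
    fun k k' => by ext; simp [add_smul]

@[simp]
theorem scale_apply {ι : Type*} (k : ι →₀ Sᵐᵒᵖ) (y : B) (i : ι) :
    scale S ι B k y i = (k i).unop • y := rfl

/-- The subgroup of `B^(ι)` generated by the multiples of relations between the `cᵢ`. -/
noncomputable def relMultiples (B : Type*) [AddCommGroup B] [Module S B] {ι : Type*} (c : ι → A) :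
    AddSubgroup (ι →₀ B) :=
  AddSubgroup.closure
    {p | ∃ (k : ι →₀ Sᵐᵒᵖ) (y : B), Finsupp.linearCombination Sᵐᵒᵖ c k = 0 ∧ p = scale S ι B k y}

theorem exists_of_mem_relMultiples {ι : Type*} {c : ι → A} {p : ι →₀ B}
    (hp : p ∈ relMultiples (S := S) B c) :
    ∃ (n : ℕ) (k : Fin n → ι →₀ Sᵐᵒᵖ) (z : Fin n → B),
      (∀ j, Finsupp.linearCombination Sᵐᵒᵖ c (k j) = 0) ∧
        p = ∑ j, scale S ι B (k j) (z j) := by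
  induction hp using AddSubgroup.closure_induction with
  | mem p hp =>
    obtain ⟨k, y, hk, rfl⟩ := hp
    exact ⟨1, fun _ => k, fun _ => y, fun _ => hk, by simp⟩
  | zero => exact ⟨0, Fin.elim0, Fin.elim0, fun j => j.elim0, by simp⟩
  | add p q _ _ hp hq =>
    obtain ⟨n, k, z, hk, rfl⟩ := hp
    obtain ⟨m, l, w, hl, rfl⟩ := hq
    refine ⟨n + m, Fin.append k l, Fin.append z w, fun j => ?_, ?_⟩
    · induction j using Fin.addCases with
      | left j => simpa using hk j
      | right j => simpa using hl j
    · simp [Fin.sum_univ_add]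
  | neg p _ hp =>
    obtain ⟨n, k, z, hk, rfl⟩ := hp
    exact ⟨n, k, fun j => -z j, hk, by simp⟩

/-- Makes the class independent of how an element of `A` is written in the `cᵢ`. -/
theorem mk_scale_congr {ι : Type*} {c : ι → A} {k k' : ι →₀ Sᵐᵒᵖ}
    (h : Finsupp.linearCombination Sᵐᵒᵖ c k = Finsupp.linearCombination Sᵐᵒᵖ c k') (y : B) :
    (QuotientAddGroup.mk (scale S ι B k y) : (ι →₀ B) ⧸ relMultiples (S := S) B c) =
      QuotientAddGroup.mk (scale S ι B k' y) :=
  QuotientAddGroup.eq_iff_sub_mem.2 <| AddSubgroup.subset_closure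
    ⟨k - k', y, by rw [map_sub, h, sub_self], by simp⟩

/-- The equational criterion for vanishing in a tensor product: if `∑ cᵢ ⊗ pᵢ = 0`, where the `cᵢ`
generate `A`, then `p` is a sum of multiples of relations between the `cᵢ`. -/
theorem RingTensor.exists_of_sum_tmul_eq_zero {ι : Type*} {c : ι → A}
    (hc : Function.Surjective (Finsupp.linearCombination Sᵐᵒᵖ c)) {p : ι →₀ B}
    (hp : (p.sum fun i b => tmul S A B (c i) b) = 0) :
    ∃ (n : ℕ) (k : Fin n → ι →₀ Sᵐᵒᵖ) (z : Fin n → B),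
      (∀ j, Finsupp.linearCombination Sᵐᵒᵖ c (k j) = 0) ∧
        p = ∑ j, scale S ι B (k j) (z j) := by
  apply exists_of_mem_relMultiples
  choose σ hσ using hc
  -- A balanced map sending `(cᵢ, b)` to the class of `single i b`, so its lift sends the given
  -- tensor to the class of `p`.
  let φ : A →+ B →+ (ι →₀ B) ⧸ relMultiples (S := S) B c :=
    AddMonoidHom.mk' (fun a => (QuotientAddGroup.mk' _).comp (scale S ι B (σ a))) fun a a' => by
      ext b
      have := mk_scale_congr (k := σ (a + a')) (k' := σ a + σ a') (c := c) (by simp [hσ]) b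
      simpa using this
  have hφ : ∀ a (s : S) b, φ (op s • a) b = φ a (s • b) := fun a s b => by
    have := mk_scale_congr (k := σ (op s • a)) (k' := op s • σ a) (c := c) (by simp [hσ]) b
    refine this.trans (congrArg _ ?_)
    ext i
    simp [mul_smul]
  have h := congrArg (lift φ hφ) hp
  rw [map_zero, map_finsuppSum] at h
  have hs : ∀ i b, φ (c i) b = QuotientAddGroup.mk' (relMultiples (S := S) B c)
      (Finsupp.single i b) := fun i b => by
    have := mk_scale_congr (k := σ (c i)) (k' := Finsupp.single i 1) (c := c) (by simp [hσ]) b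
    refine this.trans (congrArg _ ?_)
    classical
    ext j
    by_cases hj : i = j <;> simp [hj]
  simp only [lift_tmul, hs] at h
  rw [← map_finsuppSum, Finsupp.sum_single] at h
  exact (QuotientAddGroup.eq_zero_iff p).1 h

end Tensor

/-! ### Equational criterion for flatness, on both sides -/

section Flat

open scoped Matrix

/-- The equational condition for flatness: every relation `∑ uᵢ yᵢ = 0` is a consequence of
relations in the ring. -/
def HasTrivialRelations (S B : Type*) [Ring S] [AddCommGroup B] [Module S B] : Prop :=
  ∀ (n : ℕ) (u : Fin n → S) (y : Fin n → B), ∑ i, u i • y i = 0 →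
    ∃ (m : ℕ) (T : Matrix (Fin n) (Fin m) S) (z : Fin m → B),
      (∀ i, y i = ∑ j, T i j • z j) ∧ u ᵥ* T = 0

theorem sum_smul_sum_smul {S B ι κ : Type*} [Ring S] [AddCommGroup B] [Module S B]
    [Fintype ι] [Fintype κ] (u : ι → S) (T : Matrix ι κ S) (z : κ → B) :
    ∑ i, u i • ∑ j, T i j • z j = ∑ j, (u ᵥ* T) j • z j := by
  simp only [Finset.smul_sum, smul_smul, Matrix.vecMul, dotProduct, Finset.sum_smul]
  exact Finset.sum_comm

/-- Relations are trivialised one at a time: the next one is pushed through `T` to a relation on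
`z`, and the matrices multiply. -/
theorem HasTrivialRelations.exists_of_finset {S B : Type*} [Ring S] [AddCommGroup B] [Module S B]
    (h : HasTrivialRelations S B) {n : ℕ} (y : Fin n → B) (F : Finset (Fin n → S))
    (hF : ∀ u ∈ F, ∑ i, u i • y i = 0) :
    ∃ (m : ℕ) (T : Matrix (Fin n) (Fin m) S) (z : Fin m → B),
      (∀ i, y i = ∑ j, T i j • z j) ∧ ∀ u ∈ F, u ᵥ* T = 0 := by
  classical
  induction F using Finset.induction_on with
  | empty => exact ⟨n, 1, y, fun i => by simp [Matrix.one_apply], by simp⟩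
  | insert u F _ ih =>
    obtain ⟨m, T, z, hy, hT⟩ := ih fun v hv => hF v (Finset.mem_insert_of_mem hv)
    obtain ⟨l, T', w, hz, hT'⟩ := h m (u ᵥ* T) z <| by
      rw [← sum_smul_sum_smul, ← hF u (Finset.mem_insert_self u F)]
      simp only [hy]
    refine ⟨l, T * T', w, fun i => ?_, fun v hv => ?_⟩
    · simp only [hy i, hz]
      exact sum_smul_sum_smul (T i) T' w
    · rw [← Matrix.vecMul_vecMul]
      rcases Finset.mem_insert.1 hv with rfl | hv
      · exact hT'
      · rw [hT v hv, Matrix.zero_vecMul]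

/-- Flatness is tested on the inclusion into `S` of the right ideal generated by the `uᵢ`: `∑ uᵢ ⊗
yᵢ` dies in `S ⊗ B`, hence already over the ideal. -/
theorem IsFlatLeft.hasTrivialRelations {S B : Type*} [Ring S] [AddCommGroup B] [Module S B]
    (h : IsFlatLeft S B) : HasTrivialRelations S B := by
  intro n u y huy
  let J : Submodule Sᵐᵒᵖ S := Submodule.span Sᵐᵒᵖ (Set.range u)
  let c : Fin n → J := fun i => ⟨u i, Submodule.subset_span ⟨i, rfl⟩⟩
  have hc : Function.Surjective (Finsupp.linearCombination Sᵐᵒᵖ c) := by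
    intro x
    obtain ⟨k, hk⟩ := (Finsupp.mem_span_range_iff_exists_finsupp).1 x.2
    refine ⟨k, Subtype.ext ?_⟩
    rw [← hk, Finsupp.linearCombination_apply, Finsupp.sum, Finsupp.sum]
    simp [c]
  let p : Fin n →₀ B := Finsupp.equivFunOnFinite.symm y
  have hp : (p.sum fun i b => RingTensor.tmul S J B (c i) b) = 0 := by
    apply h J S J.subtype Subtype.val_injective
    rw [map_zero, map_finsuppSum, Finsupp.sum_fintype _ _ (by simp)]
    have : ∀ i, RingTensor.tmul S S B (u i) (y i) = RingTensor.tmul S S B 1 (u i • y i) :=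
      fun i => by rw [← RingTensor.smul_tmul]; simp
    simp only [RingTensor.map_tmul]
    change ∑ i, RingTensor.tmul S S B (u i) (y i) = 0
    simp only [this]
    rw [← map_sum, huy, map_zero]
  obtain ⟨m, k, z, hk, hz⟩ := RingTensor.exists_of_sum_tmul_eq_zero hc hp
  refine ⟨m, Matrix.of fun i j => (k j i).unop, z, fun i => ?_, ?_⟩
  · have := DFunLike.congr_fun hz i
    simpa [p] using this
  · ext j
    have := congrArg Subtype.val (hk j)
    rw [Finsupp.linearCombination_apply, Finsupp.sum_fintype _ _ (by simp)] at this
    simpa [c, Matrix.vecMul, dotProduct, MulOpposite.smul_eq_mul_unop] using this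

theorem RingTensor.sum_scale_tmul {S A B ι : Type*} [Ring S] [AddCommGroup A] [Module Sᵐᵒᵖ A]
    [AddCommGroup B] [Module S B] (c : ι → A) (k : ι →₀ Sᵐᵒᵖ) (y : B) :
    ((scale S ι B k y).sum fun i b => tmul S A B (c i) b) =
      tmul S A B (Finsupp.linearCombination Sᵐᵒᵖ c k) y := by
  have h : scale S ι B k y = k.mapRange (fun s => s.unop • y) (by simp) := rfl
  rw [h, Finsupp.sum_mapRange_index (by simp), Finsupp.linearCombination_apply, Finsupp.sum,
    Finsupp.sum, map_sum, AddMonoidHom.finsetSum_apply]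
  refine Finset.sum_congr rfl fun i _ => ?_
  rw [← smul_tmul, op_unop]

theorem HasTrivialRelations.isFlatLeft {S B : Type*} [Ring S] [AddCommGroup B] [Module S B]
    (h : HasTrivialRelations S B) : IsFlatLeft S B := by
  classical
  intro A A' _ _ _ _ f hf
  rw [injective_iff_map_eq_zero]
  intro x hx
  obtain ⟨p, rfl⟩ := RingTensor.exists_finsupp x
  have hq : ((p.mapDomain f).sum fun a b => RingTensor.tmul S A' B (id a) b) = 0 := by
    rw [Finsupp.sum_mapDomain_index (by simp) (by simp), ← hx, map_finsuppSum]
    rfl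
  obtain ⟨n, k, z, hk, hz⟩ := RingTensor.exists_of_sum_tmul_eq_zero
    (fun a => ⟨Finsupp.single a 1, by simp⟩) hq
  -- At points outside the image of `f` the pushed-forward `p` vanishes, so the coefficients there
  -- form relations between the `zⱼ`.
  let F : Finset (Fin n → S) :=
    ((Finset.univ.biUnion fun j => (k j).support).filter (· ∉ Set.range f)).image
      fun a j => (k j a).unop
  obtain ⟨m, T, w, hw, hT⟩ := h.exists_of_finset z F <| by
    simp only [F, Finset.mem_image, Finset.mem_filter]
    rintro _ ⟨a, ⟨_, ha⟩, rfl⟩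
    have := DFunLike.congr_fun hz a
    rw [Finsupp.mapDomain_of_notMem_range _ _ ha] at this
    simpa using this.symm
  -- The recombined relations are supported in the image of `f`, so they pull back to relations in
  -- `A`.
  let K : Fin m → A' →₀ Sᵐᵒᵖ := fun l => ∑ j, op (T j l) • k j
  have hK : ∀ l a, (K l a).unop = ((fun j => (k j a).unop) ᵥ* T) l := fun l a => by
    simp [K, Matrix.vecMul, dotProduct, Finsupp.finsetSum_apply]
  have hKr : ∀ l, ↑(K l).support ⊆ Set.range f := by
    intro l a ha
    by_contra har
    refine (Finsupp.mem_support_iff.1 ha) (unop_injective ?_)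
    rw [hK]
    by_cases hs : ∃ j, k j a ≠ 0
    · rw [hT _ (Finset.mem_image.2 ⟨a, by
          rw [Finset.mem_filter]; exact ⟨by simpa using hs, har⟩, rfl⟩)]; rfl
    · push Not at hs
      simp [hs, Matrix.vecMul, dotProduct]
  have hK0 : ∀ l, Finsupp.linearCombination Sᵐᵒᵖ id (K l) = 0 := fun l => by
    simp [K, hk]
  have hp : p = ∑ l, scale S A B ((K l).comapDomain f hf.injOn) (w l) := by
    ext a
    have := DFunLike.congr_fun hz (f a)
    rw [Finsupp.mapDomain_apply hf] at this
    rw [this]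
    simp only [Finsupp.finsetSum_apply, scale_apply, Finsupp.comapDomain_apply, hK, hw]
    exact sum_smul_sum_smul (fun j => (k j (f a)).unop) T w
  have hK' : ∀ l, Finsupp.linearCombination Sᵐᵒᵖ id ((K l).comapDomain f hf.injOn) = 0 :=
    fun l => hf <| by
      rw [map_zero, ← hK0 l, ← Finsupp.mapDomain_comapDomain f hf (K l) (hKr l),
        Finsupp.linearCombination_mapDomain, Finsupp.apply_linearCombination,
        Finsupp.mapDomain_comapDomain f hf (K l) (hKr l)]
      rfl
  rw [hp]
  rw [← Finsupp.sum_finsetSum_index (by simp) (by simp)]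
  refine Finset.sum_eq_zero fun l _ => ?_
  have := RingTensor.sum_scale_tmul id ((K l).comapDomain f hf.injOn) (w l)
  rw [hK' l] at this
  simpa using this

theorem isFlatLeft_iff {S B : Type*} [Ring S] [AddCommGroup B] [Module S B] :
    IsFlatLeft S B ↔ HasTrivialRelations S B :=
  ⟨IsFlatLeft.hasTrivialRelations, HasTrivialRelations.isFlatLeft⟩

/-- `A ⊗_S B` is `B ⊗ A` over the opposite ring. -/
def RingTensor.comm {S A B : Type*} [Ring S] [AddCommGroup A] [Module Sᵐᵒᵖ A]
    [AddCommGroup B] [Module S B] [Module Sᵐᵒᵖᵐᵒᵖ B] (h : ∀ (s : S) (b : B), op (op s) • b = s • b) :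
    RingTensor S A B ≃+ RingTensor Sᵐᵒᵖ B A :=
  AddMonoidHom.toAddEquiv
    (lift (tmul Sᵐᵒᵖ B A).flip fun a s b => by
      simp only [AddMonoidHom.flip_apply, ← smul_tmul, h])
    (lift (tmul S A B).flip fun b s a => by
      rw [← op_unop s, h]; simp only [AddMonoidHom.flip_apply, smul_tmul])
    (hom_ext fun _ _ => rfl) (hom_ext fun _ _ => rfl)

theorem RingTensor.injective_map_comm {S A B B' : Type*} [Ring S] [AddCommGroup A] [Module Sᵐᵒᵖ A]
    [AddCommGroup B] [Module S B] [Module Sᵐᵒᵖᵐᵒᵖ B] (h : ∀ (s : S) (b : B), op (op s) • b = s • b)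
    [AddCommGroup B'] [Module S B'] [Module Sᵐᵒᵖᵐᵒᵖ B']
    (h' : ∀ (s : S) (b : B'), op (op s) • b = s • b)
    (f : B →ₗ[Sᵐᵒᵖᵐᵒᵖ] B') (g : B →ₗ[S] B') (hfg : ∀ b, f b = g b) :
    Function.Injective (map (LinearMap.id : A →ₗ[Sᵐᵒᵖ] A) g) ↔
      Function.Injective (map f (LinearMap.id : A →ₗ[Sᵐᵒᵖ] A)) := by
  have key : ∀ x, map f (LinearMap.id : A →ₗ[Sᵐᵒᵖ] A) (comm h x) =
      comm h' (map (LinearMap.id : A →ₗ[Sᵐᵒᵖ] A) g x) :=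
    DFunLike.congr_fun (f := (map f (LinearMap.id : A →ₗ[Sᵐᵒᵖ] A)).comp (comm h).toAddMonoidHom)
      (g := (comm h').toAddMonoidHom.comp (map (LinearMap.id : A →ₗ[Sᵐᵒᵖ] A) g))
      (hom_ext fun a b => congrArg (fun c => tmul Sᵐᵒᵖ B' A c a) (hfg b))
  rw [← (comm h').comp_injective, ← (comm h).injective_comp]
  exact iff_of_eq (congrArg Function.Injective (funext fun x => (key x).symm))

/-- Test modules are transported along `S ≃ Sᵐᵒᵖᵐᵒᵖ`, and the tensor factors are swapped. -/
theorem isFlatRight_iff_isFlatLeft_mulOpposite {S A : Type*} [Ring S] [AddCommGroup A]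
    [Module Sᵐᵒᵖ A] : IsFlatRight S A ↔ IsFlatLeft Sᵐᵒᵖ A := by
  constructor
  · intro h B B' _ _ _ _ f hf
    let _ : Module S B := Module.compHom B (RingEquiv.opOp S).toRingHom
    let _ : Module S B' := Module.compHom B' (RingEquiv.opOp S).toRingHom
    let g : B →ₗ[S] B' := { f with map_smul' := fun s b => f.map_smul (op (op s)) b }
    exact (RingTensor.injective_map_comm (fun _ _ => rfl) (fun _ _ => rfl) f g fun _ => rfl).1
      (h B B' g hf)
  · intro h B B' _ _ _ _ g hg
    let _ : Module Sᵐᵒᵖᵐᵒᵖ B := Module.compHom B (RingEquiv.opOp S).symm.toRingHom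
    let _ : Module Sᵐᵒᵖᵐᵒᵖ B' := Module.compHom B' (RingEquiv.opOp S).symm.toRingHom
    let f : B →ₗ[Sᵐᵒᵖᵐᵒᵖ] B' :=
      { g with map_smul' := fun s b => g.map_smul s.unop.unop b }
    exact (RingTensor.injective_map_comm (fun _ _ => rfl) (fun _ _ => rfl) f g fun _ => rfl).2
      (h B B' f hg)

theorem isFlatRight_iff {S A : Type*} [Ring S] [AddCommGroup A] [Module Sᵐᵒᵖ A] :
    IsFlatRight S A ↔ HasTrivialRelations Sᵐᵒᵖ A :=
  isFlatRight_iff_isFlatLeft_mulOpposite.trans isFlatLeft_iff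

end Flat

/-! ### Splitting of relations; semi-hereditary rings -/

section Relations

open scoped Matrix

/-- For each row `u` over `S` there is a square matrix that maps into the kernel of
`u : B^n → B` and is the identity on this kernel. -/
def SplitsRelations (S B : Type*) [Ring S] [AddCommGroup B] [Module S B] : Prop :=
  ∀ (n : ℕ) (u : Fin n → S), ∃ E : Matrix (Fin n) (Fin n) S, u ᵥ* E = 0 ∧
    ∀ y : Fin n → B, ∑ i, u i • y i = 0 → ∀ i, y i = ∑ j, E i j • y j

theorem SplitsRelations.hasTrivialRelations {S B : Type*} [Ring S] [AddCommGroup B] [Module S B]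
    (h : SplitsRelations S B) : HasTrivialRelations S B := fun n u y hy =>
  let ⟨E, hE, hE'⟩ := h n u
  ⟨n, E, y, hE' y hy, hE⟩

/-- If `y = Tz` with `uT = 0`, then `E` fixes the columns of `T`, so `Ey = ETz = Tz = y`. -/
theorem SplitsRelations.of_hasTrivialRelations {S B : Type*} [Ring S] [AddCommGroup B] [Module S B]
    (hS : SplitsRelations S S) (hB : HasTrivialRelations S B) : SplitsRelations S B := by
  intro n u
  obtain ⟨E, hE, hE'⟩ := hS n u
  refine ⟨E, hE, fun y hy i => ?_⟩
  obtain ⟨m, T, z, hy, hT⟩ := hB n u y hy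
  have hET : ∀ j i, T i j = (E i ᵥ* T) j := fun j i =>
    hE' (fun i => T i j) (congrFun hT j) i
  simp only [hy]
  rw [sum_smul_sum_smul]
  exact Finset.sum_congr rfl fun j _ => by rw [hET j i]

theorem SplitsRelations.of_faithfulSMul {S B : Type*} [Ring S] [AddCommGroup B] [Module S B]
    [FaithfulSMul S B] (h : SplitsRelations S B) : SplitsRelations S S := by
  intro n u
  obtain ⟨E, hE, hE'⟩ := h n u
  refine ⟨E, hE, fun y hy i => FaithfulSMul.eq_of_smul_eq_smul (α := B) fun b => ?_⟩
  have := hE' (fun i => y i • b) (by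
    simp only [smul_smul, ← Finset.sum_smul]
    simp only [smul_eq_mul] at hy
    rw [hy, zero_smul]) i
  simpa [Finset.sum_smul, mul_smul] using this

theorem SplitsRelations.hasTrivialRelations_rightIdeal {S : Type*} [Ring S]
    (h : SplitsRelations S S) (I : RightIdeal S) : HasTrivialRelations Sᵐᵒᵖ I := by
  intro n u y hy
  obtain ⟨E, hE, hE'⟩ := h n fun i => (y i : S)
  have hu := hE' (fun i => (u i).unop) (by simpa using congrArg Subtype.val hy)
  -- `yE = 0` gives `y = y(1 - E)`, and `Eu = u` gives `(1 - E)u = 0`; passing to `Sᵐᵒᵖ` transposes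
  -- the matrix.
  refine ⟨n, Matrix.of fun i j => op ((1 - E) j i), y, fun i => Subtype.ext ?_, ?_⟩
  · have := congrFun hE i
    simp only [Matrix.vecMul, dotProduct, Pi.zero_apply] at this
    simp [mul_sub, this, Matrix.one_apply]
  · ext j
    apply unop_injective
    have := hu j
    simp only [smul_eq_mul] at this
    simp [Matrix.vecMul, dotProduct, sub_mul, Matrix.one_apply, ← this]

/-- An epimorphism splits if its kernel is the image of a retraction. -/
theorem exists_section_of_retraction {T P Q : Type*} [Ring T] [AddCommGroup P] [Module T P]
    [AddCommGroup Q] [Module T Q] {f : P →ₗ[T] Q} (hf : Function.Surjective f) {r : P →ₗ[T] P}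
    (hr : f ∘ₗ r = 0) (hr' : ∀ x, f x = 0 → r x = x) : ∃ g : Q →ₗ[T] P, f ∘ₗ g = LinearMap.id := by
  refine ⟨(LinearMap.ker f).liftQ (LinearMap.id - r) (fun x hx => ?_) ∘ₗ
    (f.quotKerEquivOfSurjective hf).symm.toLinearMap, LinearMap.ext fun y => ?_⟩
  · simp [hr' x hx]
  · obtain ⟨x, rfl⟩ := hf y
    have : (f.quotKerEquivOfSurjective hf).symm (f x) = Submodule.Quotient.mk x :=
      (LinearEquiv.symm_apply_eq _).2 rfl
    simpa [this] using LinearMap.congr_fun hr x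

theorem isRightSemihereditary_iff {S : Type*} [Ring S] :
    IsRightSemihereditary S ↔ SplitsRelations S S := by
  constructor
  · intro h n u
    let L := Fintype.linearCombination Sᵐᵒᵖ u
    have hL : ∀ x, L x = ∑ i, u i * (x i).unop := fun x => Fintype.linearCombination_apply ..
    have hI : Module.Projective Sᵐᵒᵖ (LinearMap.range L) := h _ <| by
      rw [Fintype.range_linearCombination]
      exact Submodule.fg_span (Set.finite_range u)
    obtain ⟨g, hg⟩ := L.rangeRestrict.exists_rightInverse_of_surjective L.range_rangeRestrict
    let r := LinearMap.id - g ∘ₗ L.rangeRestrict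
    have hr : ∀ x, L (r x) = 0 := fun x => by
      have := congrArg Subtype.val (LinearMap.congr_fun hg (L.rangeRestrict x))
      exact (map_sub L _ _).trans (sub_eq_zero.2 this.symm)
    have hr' : ∀ x, L x = 0 → r x = x := fun x hx => by
      have : L.rangeRestrict x = 0 := Subtype.ext hx
      simp [r, this]
    -- Column `j` is the image of the `j`-th basis vector under the retraction `r` onto the kernel
    -- of `L`.
    refine ⟨Matrix.of fun i j => (r (fun k => if j = k then 1 else 0) i).unop, ?_, fun y hy i => ?_⟩
    · ext j
      exact (hL _).symm.trans (hr _)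
    · have h1 := congrFun (hr' (fun i => op (y i)) ((hL _).trans hy)) i
      rw [LinearMap.pi_apply_eq_sum_univ r, Finset.sum_apply] at h1
      simpa using (congrArg unop h1).symm
  · intro h I hI
    obtain ⟨n, u, rfl⟩ := Submodule.fg_iff_exists_fin_generating_family.1 hI
    rw [← Fintype.range_linearCombination]
    let L := Fintype.linearCombination Sᵐᵒᵖ u
    have hL : ∀ x, L x = ∑ i, u i * (x i).unop := fun x => Fintype.linearCombination_apply ..
    obtain ⟨E, hE, hE'⟩ := h n u
    let r := Matrix.vecMulLinear (R := Sᵐᵒᵖ) (Matrix.of fun j i => op (E i j))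
    have hr : ∀ x i, (r x i).unop = ∑ j, E i j * (x j).unop := fun x i => by
      simp [r, Matrix.vecMul, dotProduct]
    obtain ⟨g, hg⟩ := exists_section_of_retraction (f := L.rangeRestrict) (r := r)
      L.surjective_rangeRestrict
      (LinearMap.ext fun x => Subtype.ext <| by
        change L (r x) = 0
        rw [hL]
        simp only [hr]
        refine (sum_smul_sum_smul u E _).trans ?_
        simp [hE])
      (fun x hx => funext fun i => unop_injective <| by
        rw [hr]
        exact (hE' (fun j => (x j).unop) ((hL x).symm.trans (congrArg Subtype.val hx)) i).symm)
    exact Module.Projective.of_split g L.rangeRestrict hg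

end Relations

/-! ### Rows and matrices of endomorphisms of `M`; the equivalences -/

section Main

open scoped Matrix

variable {R M : Type*} [Ring R] [AddCommGroup M] [Module Rᵐᵒᵖ M]

/-- The homomorphism `M^(n) → M` given by a row of endomorphisms. -/
def rowHom {n : ℕ} (u : Fin n → Module.End Rᵐᵒᵖ M) : (Fin n → M) →ₗ[Rᵐᵒᵖ] M :=
  ∑ i, u i ∘ₗ LinearMap.proj i

@[simp]
theorem rowHom_apply {n : ℕ} (u : Fin n → Module.End Rᵐᵒᵖ M) (y : Fin n → M) :
    rowHom u y = ∑ i, u i • y i := by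
  simp [rowHom]

theorem exists_rowHom {n : ℕ} (ρ : (Fin n → M) →ₗ[Rᵐᵒᵖ] M) : ∃ u, rowHom u = ρ := by
  refine ⟨fun i => ρ ∘ₗ LinearMap.single Rᵐᵒᵖ (fun _ => M) i, LinearMap.pi_ext fun i x => ?_⟩
  rw [rowHom_apply, Finset.sum_eq_single i]
  · simp
  · intro j _ hj
    simp [hj]
  · simp

theorem exists_matrix {n m : ℕ} (e : (Fin n → M) →ₗ[Rᵐᵒᵖ] (Fin m → M)) :
    ∃ E : Matrix (Fin m) (Fin n) (Module.End Rᵐᵒᵖ M), ∀ y i, e y i = ∑ j, E i j • y j := by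
  choose E hE using fun i => exists_rowHom (LinearMap.proj i ∘ₗ e)
  refine ⟨E, fun y i => ?_⟩
  rw [← rowHom_apply, hE]
  rfl

theorem vecMul_eq_zero {n m : ℕ} {u : Fin n → Module.End Rᵐᵒᵖ M}
    {K : Matrix (Fin n) (Fin m) (Module.End Rᵐᵒᵖ M)}
    (h : ∀ y : Fin m → M, ∑ i, u i • ∑ j, K i j • y j = 0) : u ᵥ* K = 0 := by
  ext j x
  have := h (Pi.single j x)
  rw [sum_smul_sum_smul, Finset.sum_eq_single j] at this
  · simpa using this
  · intro k _ hk
    simp [hk]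
  · simp

theorem splitsRelations_iff :
    SplitsRelations (Module.End Rᵐᵒᵖ M) M ↔ ∀ (n : ℕ) (ρ : (Fin n → M) →ₗ[Rᵐᵒᵖ] M),
      ∃ e : (Fin n → M) →ₗ[Rᵐᵒᵖ] (Fin n → M), ρ ∘ₗ e = 0 ∧ ∀ y, ρ y = 0 → e y = y := by
  constructor
  · intro h n ρ
    obtain ⟨u, rfl⟩ := exists_rowHom ρ
    obtain ⟨E, hE, hE'⟩ := h n u
    refine ⟨LinearMap.pi fun i => rowHom (E i), LinearMap.ext fun y => ?_, fun y hy => ?_⟩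
    · simp only [LinearMap.comp_apply, rowHom_apply, LinearMap.pi_apply, sum_smul_sum_smul, hE]
      simp
    · ext i
      rw [LinearMap.pi_apply, rowHom_apply, ← hE' y ((rowHom_apply u y).symm.trans hy)]
  · intro h n u
    obtain ⟨e, he, he'⟩ := h n (rowHom u)
    obtain ⟨E, hE⟩ := exists_matrix e
    refine ⟨E, vecMul_eq_zero fun y => ?_, fun y hy i => ?_⟩
    · simp only [← hE, ← rowHom_apply u]
      exact LinearMap.congr_fun he y
    · rw [← hE, he' y ((rowHom_apply u y).trans hy)]

/-- The retractions onto kernels of maps to `M` give retractions onto kernels of maps to `M^(m)`. -/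
theorem SplitsRelations.exists_retraction (h : SplitsRelations (Module.End Rᵐᵒᵖ M) M) {n m : ℕ}
    (ρ : (Fin n → M) →ₗ[Rᵐᵒᵖ] (Fin m → M)) :
    ∃ e : (Fin n → M) →ₗ[Rᵐᵒᵖ] (Fin n → M), ρ ∘ₗ e = 0 ∧ ∀ y, ρ y = 0 → e y = y := by
  induction m with
  | zero => exact ⟨LinearMap.id, LinearMap.ext fun _ => Subsingleton.elim _ _, fun _ _ => rfl⟩
  | succ m ih =>
    obtain ⟨e, he, he'⟩ := splitsRelations_iff.1 h n (LinearMap.proj 0 ∘ₗ ρ)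
    obtain ⟨d, hd, hd'⟩ := ih (LinearMap.pi fun i => LinearMap.proj i.succ ∘ₗ ρ ∘ₗ e)
    -- `e` handles coordinate `0`; `d` handles the others after `e`.
    refine ⟨e ∘ₗ d, LinearMap.ext fun y => funext fun i => ?_, fun y hy => ?_⟩
    · cases i using Fin.cases with
      | zero => exact LinearMap.congr_fun he (d y)
      | succ i => exact congrFun (LinearMap.congr_fun hd y) i
    · have hey : e y = y := he' y (congrFun hy 0)
      rw [LinearMap.comp_apply, hd' y, hey]
      ext i
      simp [hey, hy]

theorem isFiniteSigmaRickart_iff :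
    IsFiniteSigmaRickart R M ↔ SplitsRelations (Module.End Rᵐᵒᵖ M) M := by
  constructor
  · refine fun h => splitsRelations_iff.2 fun n ρ => ?_
    rcases n with _ | n
    · exact ⟨LinearMap.id, LinearMap.ext fun y => by rw [Subsingleton.elim y 0]; simp,
        fun _ _ => rfl⟩
    -- Embedding `M` as a coordinate turns `ρ` into an endomorphism with the same kernel.
    · obtain ⟨K, hK⟩ := h (n + 1) n.succ_pos (LinearMap.single _ _ 0 ∘ₗ ρ)
      have hker : LinearMap.ker (LinearMap.single Rᵐᵒᵖ (fun _ : Fin (n + 1) => M) 0 ∘ₗ ρ) =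
          LinearMap.ker ρ :=
        LinearMap.ker_comp_of_ker_eq_bot _ (LinearMap.ker_eq_bot.2 (Pi.single_injective (M := fun _ : Fin (n + 1) => M) 0))
      rw [hker] at hK
      refine ⟨Submodule.projection _ _ hK, LinearMap.ext fun y => ?_, fun y hy => ?_⟩
      · exact LinearMap.mem_ker.1 (Submodule.projection_apply_mem hK y)
      · exact Submodule.projection_apply_left hK ⟨y, hy⟩
  · intro h n _ φ
    obtain ⟨e, he, he'⟩ := h.exists_retraction φ
    exact ⟨_, LinearMap.isCompl_of_proj
      (f := e.codRestrict (LinearMap.ker φ) fun y => LinearMap.congr_fun he y)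
      fun y => Subtype.ext (he' y y.2)⟩

theorem SplitsRelations.isIntrinsicallyProjective
    (h : SplitsRelations (Module.End Rᵐᵒᵖ M) M) : IsIntrinsicallyProjective R M := by
  intro n _ N α hα β
  obtain ⟨e, he, he'⟩ := splitsRelations_iff.1 h n (N.subtype ∘ₗ α)
  obtain ⟨g, hg⟩ := exists_section_of_retraction hα (r := e)
    (LinearMap.ext fun y => Subtype.ext (LinearMap.congr_fun he y))
    fun y hy => he' y (congrArg Subtype.val hy)
  exact ⟨g ∘ₗ β, by rw [← LinearMap.comp_assoc, hg, LinearMap.id_comp]⟩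

theorem SplitsRelations.isCoherentOver
    (h : SplitsRelations (Module.End Rᵐᵒᵖ M) M) : IsCoherentOver R M M := by
  refine ⟨⟨1, one_pos, LinearMap.proj 0, LinearMap.proj_surjective 0⟩, fun n hn ρ => ?_⟩
  obtain ⟨e, he, he'⟩ := splitsRelations_iff.1 h n ρ
  exact ⟨n, hn, e.codRestrict _ fun y => LinearMap.congr_fun he y,
    fun y => ⟨y, Subtype.ext (he' y y.2)⟩⟩

theorem IsCoherentOver.splitsRelations (h : IsCoherentOver R M M)
    (hI : ∀ I : RightIdeal (Module.End Rᵐᵒᵖ M), IsFlatRight (Module.End Rᵐᵒᵖ M) I) :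
    SplitsRelations (Module.End Rᵐᵒᵖ M) M := by
  classical
  intro n u
  rcases n.eq_zero_or_pos with rfl | hn
  · exact ⟨0, Subsingleton.elim _ _, fun _ _ i => i.elim0⟩
  obtain ⟨m, _, κ, hκ⟩ := h.2 n hn (rowHom u)
  obtain ⟨K, hK⟩ := exists_matrix ((LinearMap.ker (rowHom u)).subtype ∘ₗ κ)
  have huK : u ᵥ* K = 0 := vecMul_eq_zero fun y => by
    simp only [← hK, ← rowHom_apply u]
    exact (κ y).2
  let S := Module.End Rᵐᵒᵖ M
  let I : RightIdeal S := Submodule.span Sᵐᵒᵖ (Set.range u)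
  let c : Fin n → I := fun i => ⟨u i, Submodule.subset_span ⟨i, rfl⟩⟩
  -- Each column of `K` is a relation between the generators `uᵢ` of `I`; flatness trivialises all
  -- of them at once.
  let F : Finset (Fin n → Sᵐᵒᵖ) := Finset.univ.image fun (j : Fin m) i => op (K i j)
  obtain ⟨l, T, z, hz, hT⟩ := (isFlatRight_iff.1 (hI I)).exists_of_finset c F <| by
    simp only [F, Finset.mem_image]
    rintro _ ⟨j, _, rfl⟩
    apply Subtype.ext
    have := congrFun huK j
    simpa [c, Matrix.vecMul, dotProduct] using this
  have hW : ∀ j : Fin l, ∃ w : Fin n → S, (z j : S) = ∑ i, u i * w i := fun j => by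
    obtain ⟨w, hw⟩ := (Submodule.mem_span_range_iff_exists_fun Sᵐᵒᵖ).1 (z j).2
    exact ⟨fun i => (w i).unop, hw.symm⟩
  choose w hw using hW
  let W : Matrix (Fin n) (Fin l) S := Matrix.of fun i j => w j i
  let V : Matrix (Fin l) (Fin n) S := Matrix.of fun j i => (T i j).unop
  have hVK : V * K = 0 := by
    ext1 j k
    have := congrArg unop (congrFun (hT _ (Finset.mem_image_of_mem _ (Finset.mem_univ k))) j)
    simpa [V, Matrix.mul_apply, Matrix.vecMul, dotProduct] using this
  have huW : u ᵥ* (W * V) = u := by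
    rw [← Matrix.vecMul_vecMul]
    ext1 i
    have h1 := congrArg Subtype.val (hz i)
    have h2 : ∀ j, (u ᵥ* W) j = z j := fun j => (hw j).symm
    have h3 : ((∑ j, T i j • z j : I) : S) = ∑ j, (z j : S) * (T i j).unop := by simp
    exact ((Finset.sum_congr rfl fun j _ => by rw [h2 j]; rfl).trans h3.symm).trans h1.symm
  refine ⟨1 - W * V, by rw [Matrix.vecMul_sub, huW, Matrix.vecMul_one, sub_self], fun y hy i => ?_⟩
  obtain ⟨x, hx⟩ := hκ ⟨y, (rowHom_apply u y).trans hy⟩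
  have hy' : ∀ i, y i = ∑ j, K i j • x j := fun i => by
    rw [← hK, LinearMap.comp_apply, hx]
    rfl
  -- Enough for `E` to fix the whole kernel, which is the image of `K`.
  have hEK : (1 - W * V) * K = K := by 
    rw [Matrix.sub_mul, Matrix.mul_assoc, hVK, Matrix.mul_zero, Matrix.one_mul, sub_zero]
  simp only [hy']
  rw [sum_smul_sum_smul]
  exact Finset.sum_congr rfl fun j _ => congrArg (· • x j) (congrFun (congrFun hEK i) j).symm

end Main

end RickartMod

open RickartMod in
theorem mainTheorem1 {R M : Type*} [Ring R] [AddCommGroup M] [Module Rᵐᵒᵖ M] :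
    List.TFAE [
      IsFiniteSigmaRickart R M,
      IsRightSemihereditary (Module.End Rᵐᵒᵖ M) ∧ IsFlatLeft (Module.End Rᵐᵒᵖ M) M,
      IsIntrinsicallyProjective R M ∧ IsCoherentOver R M M ∧
        ∀ I : RightIdeal (Module.End Rᵐᵒᵖ M), IsFlatRight (Module.End Rᵐᵒᵖ M) I] := by
  rw [isFiniteSigmaRickart_iff, isRightSemihereditary_iff, isFlatLeft_iff]
  tfae_have 1 → 2 := fun h => ⟨h.of_faithfulSMul, h.hasTrivialRelations⟩
  tfae_have 2 → 1 := fun h => h.1.of_hasTrivialRelations h.2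
  tfae_have 1 → 3 := fun h => ⟨h.isIntrinsicallyProjective, h.isCoherentOver, fun I =>
    isFlatRight_iff.2 (h.of_faithfulSMul.hasTrivialRelations_rightIdeal I)⟩
  tfae_have 3 → 1 := fun h => h.2.1.splitsRelations h.2.2
  tfae_finish
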